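/- Setting. Let $n$ nodes $1,\dots,n$ be given. Under hypothesis $\mathcal H_\theta$, $\theta\in\{0,1\}$, node $j$ observes in rounds $t=1,2,\dots$ variables $X_j^{(t)}\in\mathcal X_j$ with law $P_{j,\theta}$, all observations being independent over nodes and rounds. Assume that $P_{j,0}$ and $P_{j,1}$ are mutually absolutely continuous for every $j$, that $P_{j,0}\ne P_{j,1}$ for at least one $j$, and that $\mathsf E_{P_{j,0}}\big[(P_{j,1}(X_j)/P_{j,0}(X_j))^{\lambda}\big]<\infty$ for all $j$ and all $\lambda\in\mathbb R$ (likelihood ratios being Radon–Nikodym derivatives). Let $W$ be a row-stochastic, irreducible and aperiodic $n\times n$ matrix with stationary distribution $\pi$. Given weights $r=(r_1,\dots,r_n)$, every node starts with the uniform belief $q_j^{(0)}$ on $\{0,1\}$. In round $t$, node $j$ computes $b_j^{(t)}(\theta)\propto q_j^{(t-1)}(\theta)\,P_{j,\theta}(X_j^{(t)})^{r_j}$, and then node $i$ forms $q_i^{(t)}(\theta)\propto\prod_{j=1}^n b_j^{(t)}(\theta)^{W_{ij}}$, both normalised over $\theta\in\{0,1\}$. Let $\ell_i^{(t)}=\log\big(q_i^{(t)}(1)/q_i^{(t)}(0)\big)$.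 The log-belief ratio test of node $i$ at time $t$ with threshold $\gamma\in\mathbb R$ and randomisation $\eta\in[0,1]$ decides for $\mathcal H_1$ if $\ell_i^{(t)}>\gamma$, with probability $\eta$ if $\ell_i^{(t)}=\gamma$, and for $\mathcal H_0$ otherwise. Let $\alpha_i^{(t)}(r;\eta,\gamma)$ and $\beta_i^{(t)}(r;\eta,\gamma)$ be its type-I error (deciding for $\mathcal H_1$ under $\mathcal H_0$) and type-II error (deciding for $\mathcal H_0$ under $\mathcal H_1$). For a prior $\xi=(\xi_0,\xi_1)$ with $\xi_0,\xi_1>0$ and $\xi_0+\xi_1=1$, the Bayes risk of a test with errors $\alpha,\beta$ is $\xi_0\alpha+\xi_1\beta$. Let $\mathsf P_{\mathsf e,\mathrm{cen}}^{(t)*}(\xi)$ be the infimum of the Bayes risk over all randomised tests based on all observations of all nodes in rounds $1,\dots,t$; let $\mathsf P_{\mathsf e,i}^{(t)*}(r,\xi)$ be the infimum over the log-belief ratio tests of node $i$ at time $t$ with weights $r$ (over all $\gamma$ and $\eta$), and let $\mathsf P_{\mathsf e,i}^{(t)*}(\xi)=\inf_{r>0}\mathsf P_{\mathsf e,i}^{(t)*}(r,\xi)$.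 Let $P_\theta=P_{1,\theta}\otimes\cdots\otimes P_{n,\theta}$ and $$\mathrm{CI}(P_0,P_1)=\max_{\lambda\in[0,1]}-\log \mathsf E_{P_0}\left[\left(\frac{dP_1}{dP_0}\right)^{\lambda}\right].$$ A sequence $e_t\ge 0$ is said to have exponent $c$ if $e_t>0$ for all large $t$ and $-\frac1t\log e_t\to c$. Theorem. Take $r=\pi^{-1}$, that is, $r_j=1/\pi_j$ for all $j$. For every node $i$ and every sequence $\eta^{(t)}\in[0,1]$, both $\alpha_i^{(t)}(\pi^{-1};\eta^{(t)},0)$ and $\beta_i^{(t)}(\pi^{-1};\eta^{(t)},0)$ have exponent $\mathrm{CI}(P_0,P_1)$. Moreover, for every prior $\xi$ with $\xi_0,\xi_1>0$, the optimal centralised Bayes risk $\mathsf P_{\mathsf e,\mathrm{cen}}^{(t)*}(\xi)$ has exponent $\mathrm{CI}(P_0,P_1)$, and for every node $i$ so have the Bayes risk $\xi_0\alpha_i^{(t)}(\pi^{-1};\eta^{(t)},0)+\xi_1\beta_i^{(t)}(\pi^{-1};\eta^{(t)},0)$ of the zero-threshold test (for every sequence $\eta^{(t)}\in[0,1]$)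 and the optimal decentralised Bayes risks $\mathsf P_{\mathsf e,i}^{(t)*}(\pi^{-1},\xi)$ and $\mathsf P_{\mathsf e,i}^{(t)*}(\xi)$. -/

import Mathlib

open MeasureTheory Filter Topology

namespace SocialHT

noncomputable section

variable {n : ℕ} {X : Fin n → Type*} [∀ j, MeasurableSpace (X j)]

/-- Irreducible and aperiodic transition matrix: `W` is row-stochastic, its positive entries form a
strongly connected directed graph, and at every node the greatest common divisor of the possible
return times is one. -/
structure IsErgodicWeight (W : Matrix (Fin n) (Fin n) ℝ) : Prop where
  stochastic : W ∈ Matrix.rowStochastic ℝ (Fin n)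
  irreducible : W.IsIrreducible
  aperiodic : ∀ (i : Fin n) (d : ℕ), (∀ k : ℕ, 0 < k → 0 < (W ^ k) i i → d ∣ k) → d = 1

/-- `π` is a stationary probability vector of `W`. -/
def IsStationary (W : Matrix (Fin n) (Fin n) ℝ) (π : Fin n → ℝ) : Prop :=
  π ∈ stdSimplex ℝ (Fin n) ∧ Matrix.vecMul π W = π

/-- Joint law, under hypothesis `θ`, of the observations of all nodes in rounds `1, …, t`:
independent over nodes and rounds, the observation of node `j` having law `P θ j`. -/
def obsLaw (P : Fin 2 → ∀ j, Measure (X j)) (θ : Fin 2) (t : ℕ) :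
    Measure (Fin t → ∀ j, X j) :=
  Measure.pi fun _ : Fin t => Measure.pi (P θ)

/-- Likelihood `P_{j,θ}(x)`: density of `P θ j` with respect to the common dominating measure
`P 0 j + P 1 j` (the choice of dominating measure cancels in the normalised updates below). -/
def likelihood (P : Fin 2 → ∀ j, Measure (X j)) (j : Fin n) (θ : Fin 2) (x : X j) : ℝ :=
  ((P θ j).rnDeriv (P 0 j + P 1 j) x).toReal

/-- Local update: node `j` multiplies its current belief by the likelihood of its new observation
raised to the power `r j`, and normalises. -/
def localUpdate (P : Fin 2 → ∀ j, Measure (X j)) (r : Fin n → ℝ)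
    (q : Fin n → Fin 2 → ℝ) (x : ∀ j, X j) (j : Fin n) (θ : Fin 2) : ℝ :=
  (q j θ * likelihood P j θ (x j) ^ r j) / ∑ θ' : Fin 2, q j θ' * likelihood P j θ' (x j) ^ r j

/-- Consensus step: node `i` takes the normalised geometric average of the beliefs `b j` with
weights `W i j`. -/
def geomAverage (W : Matrix (Fin n) (Fin n) ℝ) (b : Fin n → Fin 2 → ℝ) (i : Fin n) (θ : Fin 2) :
    ℝ :=
  (∏ j, b j θ ^ W i j) / ∑ θ' : Fin 2, ∏ j, b j θ' ^ W i j

/-- Beliefs of all nodes after `t` rounds, started from the uniform belief. -/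
def belief (W : Matrix (Fin n) (Fin n) ℝ) (P : Fin 2 → ∀ j, Measure (X j)) (r : Fin n → ℝ) :
    (t : ℕ) → (Fin t → ∀ j, X j) → Fin n → Fin 2 → ℝ
  | 0, _ => fun _ _ => 1 / 2
  | t + 1, x =>
      geomAverage W (localUpdate P r (belief W P r t fun s => x s.castSucc) (x (Fin.last t)))

/-- Log-belief ratio `ℓ_i^{(t)}` of node `i`. -/
def logBeliefRatio (W : Matrix (Fin n) (Fin n) ℝ) (P : Fin 2 → ∀ j, Measure (X j)) (r : Fin n → ℝ)
    (i : Fin n) (t : ℕ) (x : Fin t → ∀ j, X j) : ℝ :=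
  Real.log (belief W P r t x i 1 / belief W P r t x i 0)

/-- Randomised threshold rule; its value is the probability of deciding for hypothesis `1`. -/
def thresholdRule (γ η ℓ : ℝ) : ℝ :=
  if γ < ℓ then 1 else if ℓ = γ then η else 0

/-- Log-belief ratio test of node `i` at time `t`, with threshold `γ` and randomisation `η`. -/
def lbrTest (W : Matrix (Fin n) (Fin n) ℝ) (P : Fin 2 → ∀ j, Measure (X j)) (r : Fin n → ℝ)
    (γ η : ℝ) (i : Fin n) (t : ℕ) (x : Fin t → ∀ j, X j) : ℝ :=
  thresholdRule γ η (logBeliefRatio W P r i t x)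

/-- Type-I error probability of a randomised test. -/
def typeI (P : Fin 2 → ∀ j, Measure (X j)) (t : ℕ) (φ : (Fin t → ∀ j, X j) → ℝ) : ℝ :=
  ∫ x, φ x ∂obsLaw P 0 t

/-- Type-II error probability of a randomised test. -/
def typeII (P : Fin 2 → ∀ j, Measure (X j)) (t : ℕ) (φ : (Fin t → ∀ j, X j) → ℝ) : ℝ :=
  ∫ x, (1 - φ x) ∂obsLaw P 1 t

/-- Bayes risk of a randomised test under the prior `ξ`. -/
def bayesRisk (P : Fin 2 → ∀ j, Measure (X j)) (ξ : Fin 2 → ℝ) (t : ℕ)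
    (φ : (Fin t → ∀ j, X j) → ℝ) : ℝ :=
  ξ 0 * typeI P t φ + ξ 1 * typeII P t φ

/-- Optimal centralised Bayes risk: all randomised tests based on all observations of all nodes in
the first `t` rounds compete. -/
def centralBayesRisk (P : Fin 2 → ∀ j, Measure (X j)) (ξ : Fin 2 → ℝ) (t : ℕ) : ℝ :=
  sInf {R | ∃ φ : (Fin t → ∀ j, X j) → ℝ,
    Measurable φ ∧ (∀ x, φ x ∈ Set.Icc (0 : ℝ) 1) ∧ R = bayesRisk P ξ t φ}

/-- Optimal Bayes risk of node `i` over its log-belief ratio tests, for given weights `r`. -/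
def nodeBayesRisk (W : Matrix (Fin n) (Fin n) ℝ) (P : Fin 2 → ∀ j, Measure (X j)) (r : Fin n → ℝ)
    (ξ : Fin 2 → ℝ) (i : Fin n) (t : ℕ) : ℝ :=
  sInf {R | ∃ γ : ℝ, ∃ η ∈ Set.Icc (0 : ℝ) 1, R = bayesRisk P ξ t (lbrTest W P r γ η i t)}

/-- Optimal Bayes risk of node `i` over its log-belief ratio tests and over all positive weights. -/
def nodeBayesRiskOpt (W : Matrix (Fin n) (Fin n) ℝ) (P : Fin 2 → ∀ j, Measure (X j))
    (ξ : Fin 2 → ℝ) (i : Fin n) (t : ℕ) : ℝ :=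
  sInf {R | ∃ r : Fin n → ℝ, (∀ j, 0 < r j) ∧ R = nodeBayesRisk W P r ξ i t}

/-- The sequence `e` is eventually positive and decays with exponent exactly `c`. -/
def HasExponent (e : ℕ → ℝ) (c : ℝ) : Prop :=
  (∀ᶠ t in atTop, 0 < e t) ∧ Tendsto (fun t : ℕ => -(1 / (t : ℝ)) * Real.log (e t)) atTop (𝓝 c)

/-- Chernoff information `max_{λ ∈ [0,1]} - log E_μ[(dν/dμ)^λ]` of mutually absolutely continuous
probability measures. -/
def chernoffInformation {Ω : Type*} [MeasurableSpace Ω] (μ ν : Measure Ω) : ℝ :=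
  sSup ((fun l : ℝ => -Real.log (∫ x, (ν.rnDeriv μ x).toReal ^ l ∂μ)) '' Set.Icc (0 : ℝ) 1)

end

end SocialHT

/-!
In log-belief ratios both update rules are linear. Hence, outside a null set, `ℓ_i^{(t)}` is a
weighted sum of the log-likelihood ratios of all observations, an observation of node `j` made `k`
rounds before the last one having weight `(W ^ (k + 1)) i j * r j`
(`logBeliefRatio_eq_weightedLlr`). Doeblin's contraction argument gives `(W ^ k) i j → π j`
(`tendsto_pow_apply`), so for `r = π⁻¹` the weights tend to one. The normalised cumulant generating
functions of `ℓ_i^{(t)}` are then Cesàro means that converge to the cumulant generating function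
`Λ` of the total log-likelihood ratio of a single round (`tendsto_log_mgf_weightedLlr`); no rate of
convergence of `W ^ k` is needed.

`exp ∘ Λ` is strictly convex and equals one at `0` and `1`, so `Λ` has a unique minimiser `l₀`,
which lies strictly between `0` and `1`, and the Chernoff information is `-Λ l₀`
(`exists_roundCgf_minimizer`). A version of Cramér's theorem at threshold zero
(`hasExponent_of_tendsto_log_mgf`) gives the exponent `-Λ l₀` for the type-I error: the upper bound
is Chernoff's, and the lower bound compares exponential moments at three nearby points, using
`Λ' l₀ = 0`. Under hypothesis `1` the function `Λ` is replaced by `l ↦ Λ (1 - l)`, which has the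
same minimum; this settles the type-II error.

For the Bayes risks, every test based on all observations has risk at least
`min (ξ 0) (ξ 1)` times the probability under hypothesis `0` that the unweighted sum of the
log-likelihood ratios is positive (`min_mul_measureReal_le_bayesRisk`). The same version of
Cramér's theorem, with all weights equal to one, gives this probability the Chernoff information
as exponent. Each optimal risk lies between this bound and the risk of the zero-threshold test of
a node with weights `π⁻¹`.
-/

namespace SocialHT

/-! ### Convergence of an ergodic weight matrix to its stationary distribution -/

section Matrix

open Matrix

variable {n : ℕ} {W : Matrix (Fin n) (Fin n) ℝ} {π : Fin n → ℝ}

theorem pow_add_apply_pos (hW : ∀ i j, 0 ≤ W i j) {a b : ℕ} {i j k : Fin n}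
    (h₁ : 0 < (W ^ a) i j) (h₂ : 0 < (W ^ b) j k) : 0 < (W ^ (a + b)) i k := by
  rw [pow_add, mul_apply]
  exact Finset.sum_pos' (fun l _ => mul_nonneg (pow_apply_nonneg hW a i l)
    (pow_apply_nonneg hW b l k)) ⟨j, Finset.mem_univ j, mul_pos h₁ h₂⟩

/-- The return times to a node form an additive monoid with greatest common divisor one, hence
contain all large integers; irreducibility transports this to every entry. -/
theorem IsErgodicWeight.eventually_pow_apply_pos (hW : IsErgodicWeight W) (i j : Fin n) :
    ∀ᶠ m in atTop, 0 < (W ^ m) i j := by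
  have h0 := hW.irreducible.nonneg
  let s : Set ℕ := {k | 0 < k ∧ 0 < (W ^ k) i i}
  have hgcd : Nat.setGcd s = 1 :=
    hW.aperiodic i _ fun k hk hpos => Nat.setGcd_dvd_of_mem ⟨hk, hpos⟩
  obtain ⟨N, hN⟩ := Nat.exists_mem_closure_of_ge s
  have hret : ∀ m ∈ AddSubmonoid.closure s, 0 < (W ^ m) i i := by
    intro m hm
    induction hm using AddSubmonoid.closure_induction with
    | mem x hx => exact hx.2
    | zero => simp
    | add x y _ _ hx hy => exact pow_add_apply_pos h0 hx hy
  obtain ⟨k, -, hk⟩ := (isIrreducible_iff_exists_pow_pos h0).1 hW.irreducible i j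
  filter_upwards [eventually_ge_atTop (N + k)] with m hm
  obtain ⟨l, rfl⟩ := Nat.exists_eq_add_of_le' (le_of_add_le_right hm)
  exact pow_add_apply_pos h0 (hret l (hN l (by omega) (by rw [hgcd]; exact one_dvd l))) hk

theorem IsStationary.vecMul_pow (hπ : IsStationary W π) (m : ℕ) : π ᵥ* W ^ m = π := by
  induction m with
  | zero => simp
  | succ m ih => rw [pow_succ, ← vecMul_vecMul, ih, hπ.2]

theorem IsStationary.pos (hW : IsErgodicWeight W) (hπ : IsStationary W π) (j : Fin n) :
    0 < π j := by
  have h0 := hW.irreducible.nonneg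
  obtain ⟨i, hi⟩ : ∃ i, 0 < π i := by
    by_contra! h
    have := Finset.sum_nonpos fun i (_ : i ∈ Finset.univ) => h i
    linarith [hπ.1.2]
  obtain ⟨m, hm⟩ := (hW.eventually_pow_apply_pos i j).exists
  rw [← hπ.vecMul_pow m]
  exact Finset.sum_pos' (fun l _ => mul_nonneg (hπ.1.1 l) (pow_apply_nonneg h0 m l j))
    ⟨i, Finset.mem_univ i, mul_pos hi hm⟩

theorem norm_mulVec_le_of_row_sum {B : Matrix (Fin n) (Fin n) ℝ} {c : ℝ} (hc : 0 ≤ c)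
    (hB : ∀ i j, 0 ≤ B i j) (hs : ∀ i, ∑ j, B i j = c) (v : Fin n → ℝ) :
    ‖B *ᵥ v‖ ≤ c * ‖v‖ := by
  refine (pi_norm_le_iff_of_nonneg (by positivity)).2 fun i => ?_
  calc ‖∑ j, B i j * v j‖ ≤ ∑ j, ‖B i j * v j‖ := norm_sum_le _ _
    _ ≤ ∑ j, B i j * ‖v‖ := Finset.sum_le_sum fun j _ => by
        rw [norm_mul, Real.norm_of_nonneg (hB i j)]
        exact mul_le_mul_of_nonneg_left (norm_le_pi_norm v j) (hB i j)
    _ = c * ‖v‖ := by rw [← Finset.sum_mul, hs]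

/-- Doeblin's contraction: on vectors annihilated by the stationary distribution, a power of `W`
with positive entries acts as a nonnegative matrix whose row sums are less than one. -/
theorem tendsto_pow_mulVec_zero (hW : IsErgodicWeight W) (hπ : IsStationary W π) {v : Fin n → ℝ}
    (hv : π ⬝ᵥ v = 0) : Tendsto (fun m => ‖W ^ m *ᵥ v‖) atTop (𝓝 0) := by
  have hst : ∀ m, W ^ m ∈ rowStochastic ℝ (Fin n) := fun m => pow_mem hW.stochastic m
  obtain ⟨N, hN⟩ : ∃ N, ∀ i j, 0 < (W ^ N) i j :=
    (eventually_all.2 fun i => eventually_all.2 fun j =>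
      hW.eventually_pow_apply_pos i j).exists
  obtain ⟨δ, ⟨hδW, hδ1⟩, hδ0⟩ : ∃ δ : ℝ, ((∀ i j, δ < (W ^ N) i j) ∧ δ < 1) ∧ 0 < δ := by
    have hlt : ∀ a : ℝ, 0 < a → ∀ᶠ δ in 𝓝[>] (0 : ℝ), δ < a := fun a ha =>
      nhdsWithin_le_nhds (eventually_lt_nhds ha)
    exact (((eventually_all.2 fun i => eventually_all.2 fun j => hlt _ (hN i j)).and
      (hlt 1 one_pos)).and self_mem_nhdsWithin).exists
  have horth : ∀ m, π ⬝ᵥ (W ^ m *ᵥ v) = 0 := fun m => by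
    rw [dotProduct_mulVec, hπ.vecMul_pow, hv]
  have hanti : Antitone fun m => ‖W ^ m *ᵥ v‖ := antitone_nat_of_succ_le fun m => by
    rw [pow_succ', ← mulVec_mulVec]
    simpa using norm_mulVec_le_of_row_sum zero_le_one (fun i j => hW.irreducible.nonneg i j)
      (sum_row_of_mem_rowStochastic hW.stochastic) (W ^ m *ᵥ v)
  have hcontr : ∀ m, ‖W ^ (m + N) *ᵥ v‖ ≤ (1 - δ) * ‖W ^ m *ᵥ v‖ := fun m => by
    have hsub : W ^ (m + N) *ᵥ v = (W ^ N - of fun _ j => δ * π j) *ᵥ (W ^ m *ᵥ v) := by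
      rw [sub_mulVec, mulVec_mulVec, ← pow_add, add_comm N m, eq_comm, sub_eq_self]
      ext i
      have := horth m
      simp only [mulVec, dotProduct, of_apply, mul_assoc, ← Finset.mul_sum] at this ⊢
      rw [this, mul_zero]; rfl
    rw [hsub]
    refine norm_mulVec_le_of_row_sum (by linarith) (fun i j => ?_) (fun i => ?_) _
    · have hπ1 : π j ≤ 1 := by
        rw [← hπ.1.2]
        exact Finset.single_le_sum (fun l _ => hπ.1.1 l) (Finset.mem_univ j)
      have := mul_le_mul_of_nonneg_left hπ1 hδ0.le
      change 0 ≤ (W ^ N) i j - δ * π j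
      linarith [hδW i j]
    · simp [Finset.sum_sub_distrib, sum_row_of_mem_rowStochastic (hst N) i, ← Finset.mul_sum,
        hπ.1.2]
  have hlim := tendsto_atTop_ciInf hanti ⟨0, by rintro _ ⟨m, rfl⟩; exact norm_nonneg _⟩
  have h0 := ge_of_tendsto' hlim fun m => norm_nonneg _
  have h1 := le_of_tendsto_of_tendsto' ((tendsto_add_atTop_iff_nat N).2 hlim)
    (hlim.const_mul (1 - δ)) hcontr
  have : (⨅ m, ‖W ^ m *ᵥ v‖) = 0 := by nlinarith
  rwa [this] at hlim

theorem tendsto_pow_apply (hW : IsErgodicWeight W) (hπ : IsStationary W π) (i j : Fin n) :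
    Tendsto (fun m => (W ^ m) i j) atTop (𝓝 (π j)) := by
  have hv : π ⬝ᵥ (Pi.single j 1 - fun _ => π j) = 0 := by
    rw [dotProduct_sub, dotProduct_single_one, sub_eq_zero]
    simp [dotProduct, ← Finset.sum_mul, hπ.1.2]
  refine tendsto_iff_norm_sub_tendsto_zero.2 (squeeze_zero (fun _ => norm_nonneg _) (fun m => ?_)
    (tendsto_pow_mulVec_zero hW hπ hv))
  refine le_of_eq_of_le (congrArg (fun a : ℝ => ‖a‖) ?_)
    (norm_le_pi_norm (W ^ m *ᵥ (Pi.single j 1 - fun _ => π j)) i)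
  have hs := sum_row_of_mem_rowStochastic (pow_mem hW.stochastic m) i
  rw [mulVec_sub, mulVec_single_one]
  simp [mulVec, dotProduct, ← Finset.sum_mul, hs]

end Matrix

/-! ### Exponents of sequences -/

section Exponent

theorem hasExponent_iff {e : ℕ → ℝ} {c : ℝ} :
    HasExponent e c ↔ ∀ ε > 0, ∀ᶠ t : ℕ in atTop,
      Real.exp (t * (-c - ε)) ≤ e t ∧ e t ≤ Real.exp (t * (-c + ε)) := by
  have key : ∀ (ε : ℝ) (t : ℕ), 0 < t → 0 < e t →
      (|-(1 / (t : ℝ)) * Real.log (e t) - c| ≤ ε ↔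
        Real.exp (t * (-c - ε)) ≤ e t ∧ e t ≤ Real.exp (t * (-c + ε))) := by
    intro ε t ht he
    have ht' : (0 : ℝ) < t := Nat.cast_pos.2 ht
    rw [← Real.le_log_iff_exp_le he, ← Real.log_le_iff_le_exp he, abs_le]
    have : -(1 / (t : ℝ)) * Real.log (e t) = -(Real.log (e t) / t) := by ring
    rw [this]
    constructor
    · rintro ⟨h1, h2⟩
      refine ⟨?_, ?_⟩
      · rw [mul_comm, ← le_div_iff₀ ht']; linarith
      · rw [mul_comm (t : ℝ), ← div_le_iff₀ ht']; linarith
    · rintro ⟨h1, h2⟩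
      rw [mul_comm, ← le_div_iff₀ ht'] at h1
      rw [mul_comm (t : ℝ), ← div_le_iff₀ ht'] at h2
      constructor <;> linarith
  constructor
  · rintro ⟨hpos, hlim⟩ ε hε
    filter_upwards [hpos, eventually_gt_atTop 0, Metric.tendsto_nhds.1 hlim ε hε] with t h1 h2 h3
    exact (key ε t h2 h1).1 (by rw [← Real.dist_eq]; exact h3.le)
  · intro h
    have hpos : ∀ᶠ t in atTop, 0 < e t :=
      (h 1 one_pos).mono fun t ht => (Real.exp_pos _).trans_le ht.1
    refine ⟨hpos, Metric.tendsto_nhds.2 fun ε hε => ?_⟩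
    filter_upwards [hpos, eventually_gt_atTop 0, h (ε / 2) (half_pos hε)] with t h1 h2 h3
    rw [Real.dist_eq]
    linarith [(key (ε / 2) t h2 h1).2 h3]

theorem HasExponent.squeeze {e₁ e₂ e : ℕ → ℝ} {c : ℝ} (h₁ : HasExponent e₁ c)
    (h₂ : HasExponent e₂ c) (hle₁ : ∀ t, e₁ t ≤ e t) (hle₂ : ∀ t, e t ≤ e₂ t) :
    HasExponent e c := by
  rw [hasExponent_iff] at *
  intro ε hε
  filter_upwards [h₁ ε hε, h₂ ε hε] with t h1 h2
  exact ⟨h1.1.trans (hle₁ t), (hle₂ t).trans h2.2⟩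

theorem HasExponent.const_mul {e : ℕ → ℝ} {c a : ℝ} (ha : 0 < a) (h : HasExponent e c) :
    HasExponent (fun t => a * e t) c := by
  refine ⟨h.1.mono fun t ht => mul_pos ha ht, ?_⟩
  have h0 : Tendsto (fun t : ℕ => -(1 / (t : ℝ)) * Real.log a) atTop (𝓝 0) := by
    simpa using (tendsto_one_div_atTop_nhds_zero_nat (𝕜 := ℝ)).neg.mul_const (Real.log a)
  have := h0.add h.2
  rw [zero_add] at this
  refine this.congr' (h.1.mono fun t ht => ?_)
  change _ = -(1 / (t : ℝ)) * Real.log (a * e t)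
  rw [Real.log_mul ha.ne' ht.ne']
  ring

theorem HasExponent.add {e₁ e₂ : ℕ → ℝ} {c : ℝ} (h₁ : HasExponent e₁ c)
    (h₂ : HasExponent e₂ c) : HasExponent (fun t => e₁ t + e₂ t) c := by
  -- The sum lies between twice the minimum and twice the maximum of the two terms.
  have hmax : HasExponent (fun t => max (e₁ t) (e₂ t)) c := by
    rw [hasExponent_iff] at *
    intro ε hε
    filter_upwards [h₁ ε hε, h₂ ε hε] with t h1 h2
    exact ⟨h1.1.trans (le_max_left _ _), max_le h1.2 h2.2⟩
  have hmin : HasExponent (fun t => 2 * min (e₁ t) (e₂ t)) c := by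
    refine HasExponent.const_mul two_pos ?_
    rw [hasExponent_iff] at *
    intro ε hε
    filter_upwards [h₁ ε hε, h₂ ε hε] with t h1 h2
    exact ⟨le_min h1.1 h2.1, (min_le_left _ _).trans h1.2⟩
  refine hmin.squeeze (hmax.const_mul two_pos) (fun t => ?_) fun t => ?_
  · linarith [min_le_left (e₁ t) (e₂ t), min_le_right (e₁ t) (e₂ t)]
  · linarith [le_max_left (e₁ t) (e₂ t), le_max_right (e₁ t) (e₂ t)]

end Exponent

/-! ### Cramér's theorem at threshold zero -/

section Cramer

open ProbabilityTheory

variable {Ω : ℕ → Type*} [∀ t, MeasurableSpace (Ω t)] {μ : ∀ t, Measure (Ω t)}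
  {S : ∀ t, Ω t → ℝ} {Λ : ℝ → ℝ} {l₀ : ℝ}

/-- If `S` exceeds `a > 0` then `exp (l S)` is controlled by a larger exponential moment; if
`S ≤ 0`, by the smaller exponential moment `l₀`. Only the range `0 < S ≤ a` needs the event
`0 < S`, and there `exp (l S) ≤ exp (a l)`. -/
theorem mgf_le_add_measureReal {Ω : Type*} [MeasurableSpace Ω] {μ : Measure Ω}
    [IsProbabilityMeasure μ] {S : Ω → ℝ} (hS : Measurable S)
    (hint : ∀ l, Integrable (fun x => Real.exp (l * S x)) μ) {l₀ l h a : ℝ} (h₀ : 0 < l)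
    (hl : l₀ ≤ l) (hh : 0 ≤ h) :
    mgf S μ l ≤ mgf S μ l₀ + Real.exp (a * l) * μ.real {x | 0 < S x} +
      Real.exp (-(a * h)) * mgf S μ (l + h) := by
  have hm : MeasurableSet {x | 0 < S x} := measurableSet_lt measurable_const hS
  have hi : Integrable ({x | 0 < S x}.indicator fun _ => Real.exp (a * l)) μ :=
    (integrable_const _).indicator hm
  have key : mgf S μ l ≤ ∫ x, (Real.exp (l₀ * S x) +
      {x | 0 < S x}.indicator (fun _ => Real.exp (a * l)) x +
      Real.exp (-(a * h)) * Real.exp ((l + h) * S x)) ∂μ := by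
    refine integral_mono (hint l) (((hint l₀).add hi).add ((hint _).const_mul _)) fun x => ?_
    have hind : 0 ≤ {x | 0 < S x}.indicator (fun _ => Real.exp (a * l)) x :=
      Set.indicator_nonneg (fun _ _ => (Real.exp_pos _).le) x
    have h1 := Real.exp_pos (l₀ * S x)
    have h3 : 0 < Real.exp (-(a * h)) * Real.exp ((l + h) * S x) := by positivity
    dsimp only
    rcases le_or_gt (S x) 0 with hx | hx
    · have : Real.exp (l * S x) ≤ Real.exp (l₀ * S x) :=
        Real.exp_le_exp.2 (mul_le_mul_of_nonpos_right hl hx)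
      linarith
    · rcases le_or_gt (S x) a with hxa | hxa
      · have h2 : {x | 0 < S x}.indicator (fun _ => Real.exp (a * l)) x = Real.exp (a * l) :=
          Set.indicator_of_mem (s := {x | 0 < S x}) hx _
        have : Real.exp (l * S x) ≤ Real.exp (a * l) := Real.exp_le_exp.2 (by nlinarith)
        linarith
      · have : Real.exp (l * S x) ≤ Real.exp (-(a * h)) * Real.exp ((l + h) * S x) := by
          rw [← Real.exp_add]
          exact Real.exp_le_exp.2 (by nlinarith)
        linarith
  refine key.trans_eq ?_
  have h12 : Integrable (fun x => Real.exp (l₀ * S x) +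
      {x | 0 < S x}.indicator (fun _ => Real.exp (a * l)) x) μ := (hint l₀).add hi
  rw [integral_add h12 ((hint _).const_mul _), integral_add (hint l₀) hi,
    integral_indicator_const _ hm, integral_const_mul]
  simp [mgf, mul_comm]

theorem eventually_exp_le_and_le_exp {a : ℕ → ℝ} {A : ℝ} (ha : ∀ t, 0 < a t)
    (h : Tendsto (fun t : ℕ => (1 / (t : ℝ)) * Real.log (a t)) atTop (𝓝 A)) {c d : ℝ}
    (hc : c < A) (hd : A < d) :
    ∀ᶠ t : ℕ in atTop, Real.exp (t * c) ≤ a t ∧ a t ≤ Real.exp (t * d) := by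
  filter_upwards [h.eventually_const_lt hc, h.eventually_lt_const hd, eventually_gt_atTop 0]
    with t h1 h2 ht
  have ht' : (0 : ℝ) < t := Nat.cast_pos.2 ht
  rw [one_div_mul_eq_div] at h1 h2
  rw [lt_div_iff₀ ht'] at h1
  rw [div_lt_iff₀ ht'] at h2
  rw [← Real.le_log_iff_exp_le (ha t), ← Real.log_le_iff_le_exp (ha t)]
  constructor <;> linarith

/-- Large deviation lower bound. Since `Λ` has derivative zero at `l₀` and is larger to the right
of it, at `l = l₀ + δ` with `δ` small both outer terms of `mgf_le_add_measureReal` (with `h = δ`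
and `a = ε' t`) are exponentially negligible against `mgf (S t) (μ t) l`. -/
theorem eventually_exp_le_measureReal_pos [∀ t, IsProbabilityMeasure (μ t)]
    (hS : ∀ t, Measurable (S t)) (hint : ∀ t l, Integrable (fun x => Real.exp (l * S t x)) (μ t))
    (hlim : ∀ l, Tendsto (fun t : ℕ => (1 / (t : ℝ)) * Real.log (mgf (S t) (μ t) l)) atTop
      (𝓝 (Λ l)))
    (hl₀ : 0 < l₀) (hder : HasDerivAt Λ 0 l₀) (hmin : ∀ l, l₀ < l → Λ l₀ < Λ l)
    {ε : ℝ} (hε : 0 < ε) :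
    ∀ᶠ t : ℕ in atTop, Real.exp (t * (Λ l₀ - ε)) ≤ (μ t).real {x | 0 < S t x} := by
  have hmgf : ∀ l t, 0 < mgf (S t) (μ t) l := fun l t => mgf_pos (hint t l)
  set ε' : ℝ := ε / (l₀ + 1) with hε'
  have hε'0 : 0 < ε' := by positivity
  obtain ⟨δ, hδ0, hδ1, hδ⟩ : ∃ δ : ℝ, 0 < δ ∧ δ ≤ 1 ∧ Λ (l₀ + δ + δ) - Λ l₀ ≤ ε' * δ := by
    have hlo := (hasDerivAt_iff_isLittleO_nhds_zero.1 hder).def (half_pos hε'0)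
    have h2 : Tendsto (fun δ : ℝ => δ + δ) (𝓝[>] 0) (𝓝 0) := by
      have : Tendsto (fun δ : ℝ => δ + δ) (𝓝 0) (𝓝 (0 + 0)) := tendsto_id.add tendsto_id
      rw [add_zero] at this
      exact this.mono_left nhdsWithin_le_nhds
    have h1 : ∀ᶠ δ in 𝓝[>] (0 : ℝ), δ < 1 := nhdsWithin_le_nhds (eventually_lt_nhds one_pos)
    obtain ⟨δ, ⟨hδ, hδ1⟩, hδ0⟩ := (((h2.eventually hlo).and h1).and self_mem_nhdsWithin).exists
    have hδ0 : 0 < δ := hδ0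
    refine ⟨δ, hδ0, hδ1.le, ?_⟩
    rw [smul_zero, sub_zero, Real.norm_eq_abs, Real.norm_of_nonneg (by positivity),
      ← add_assoc] at hδ
    linarith [le_abs_self (Λ (l₀ + δ + δ) - Λ l₀)]
  set l := l₀ + δ with hl
  have hAB : Λ l₀ < Λ l := hmin l (by linarith)
  have hCB : Λ (l + δ) - ε' * δ < Λ l := by linarith
  obtain ⟨c, hc, hcB⟩ := exists_between (max_lt hAB hCB)
  obtain ⟨d, hcd, hdB⟩ := exists_between hcB
  have hbig : ∀ᶠ t : ℕ in atTop, Real.log 3 ≤ t * (d - c) :=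
    (tendsto_natCast_atTop_atTop.atTop_mul_const (sub_pos.2 hcd)).eventually_ge_atTop _
  have hcA := (le_max_left _ _).trans_lt hc
  have hcC : Λ (l + δ) < c + ε' * δ := by linarith [(le_max_right _ _).trans_lt hc]
  filter_upwards [(eventually_exp_le_and_le_exp (hmgf l) (hlim l) hdB (lt_add_one _)),
    (eventually_exp_le_and_le_exp (hmgf l₀) (hlim l₀) (sub_one_lt _) hcA),
    (eventually_exp_le_and_le_exp (hmgf (l + δ)) (hlim (l + δ)) (sub_one_lt _) hcC), hbig]
    with t hB hA hC ht
  have hsplit := mgf_le_add_measureReal (hS t) (hint t) (l₀ := l₀) (l := l) (h := δ)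
    (a := ε' * t) (by linarith) (by linarith) hδ0.le
  have hC' : Real.exp (-(ε' * t * δ)) * mgf (S t) (μ t) (l + δ) ≤ Real.exp (t * c) := by
    refine (mul_le_mul_of_nonneg_left hC.2 (Real.exp_pos _).le).trans_eq ?_
    rw [← Real.exp_add]; congr 1; ring
  have hd : 3 * Real.exp (t * c) ≤ Real.exp (t * d) := by
    rw [← Real.exp_log (show (0 : ℝ) < 3 by norm_num), ← Real.exp_add]
    exact Real.exp_le_exp.2 (by linarith)
  have hP : Real.exp (t * c) ≤ Real.exp (ε' * t * l) * (μ t).real {x | 0 < S t x} := by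
    linarith [hB.1, hA.2]
  have hle : ε' * l ≤ ε := by
    calc ε' * l ≤ ε' * (l₀ + 1) := mul_le_mul_of_nonneg_left (by linarith) hε'0.le
      _ = ε := div_mul_cancel₀ _ (by positivity)
  calc Real.exp (t * (Λ l₀ - ε)) ≤ Real.exp (-(ε' * t * l)) * Real.exp (t * c) := by
        rw [← Real.exp_add]
        have ht0 : (0 : ℝ) ≤ t := Nat.cast_nonneg t
        have h1 : (t : ℝ) * (Λ l₀ - ε) ≤ t * (c - ε' * l) :=
          mul_le_mul_of_nonneg_left (by linarith) ht0
        exact Real.exp_le_exp.2 (by linarith)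
    _ ≤ Real.exp (-(ε' * t * l)) * (Real.exp (ε' * t * l) * (μ t).real {x | 0 < S t x}) :=
        mul_le_mul_of_nonneg_left hP (Real.exp_pos _).le
    _ = (μ t).real {x | 0 < S t x} := by
        rw [← mul_assoc, ← Real.exp_add, neg_add_cancel, Real.exp_zero, one_mul]

/-- Any quantity between the probabilities of `0 < S t` and of `0 ≤ S t` has exponent
`-Λ l₀`, where `l₀ > 0` minimises the limiting cumulant generating function `Λ`. -/
theorem hasExponent_of_tendsto_log_mgf [∀ t, IsProbabilityMeasure (μ t)]
    (hS : ∀ t, Measurable (S t)) (hint : ∀ t l, Integrable (fun x => Real.exp (l * S t x)) (μ t))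
    (hlim : ∀ l, Tendsto (fun t : ℕ => (1 / (t : ℝ)) * Real.log (mgf (S t) (μ t) l)) atTop
      (𝓝 (Λ l)))
    (hl₀ : 0 < l₀) (hder : HasDerivAt Λ 0 l₀) (hmin : ∀ l, l₀ < l → Λ l₀ < Λ l)
    {e : ℕ → ℝ} (hle₁ : ∀ t, (μ t).real {x | 0 < S t x} ≤ e t)
    (hle₂ : ∀ t, e t ≤ (μ t).real {x | 0 ≤ S t x}) : HasExponent e (-Λ l₀) := by
  refine hasExponent_iff.2 fun ε hε => ?_
  filter_upwards [eventually_exp_le_measureReal_pos hS hint hlim hl₀ hder hmin hε,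
    eventually_exp_le_and_le_exp (fun t => mgf_pos (hint t l₀)) (hlim l₀) (sub_one_lt _)
      (lt_add_of_pos_right _ hε)] with t h1 h2
  rw [neg_neg]
  refine ⟨h1.trans (hle₁ t), ((hle₂ t).trans ?_).trans h2.2⟩
  simpa using measure_ge_le_exp_mul_mgf (μ := μ t) (X := S t) 0 hl₀.le (hint t l₀)

end Cramer

/-! ### Likelihood ratios of product measures -/

section Density

theorem withDensity_exp_llr {Ω : Type*} [MeasurableSpace Ω] {μ ν : Measure Ω}
    [IsProbabilityMeasure μ] [IsProbabilityMeasure ν] (hμν : μ ≪ ν) (hνμ : ν ≪ μ) :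
    ν.withDensity (fun x => ENNReal.ofReal (Real.exp (llr μ ν x))) = μ := by
  conv_rhs => rw [← Measure.withDensity_rnDeriv_eq μ ν hμν]
  refine withDensity_congr_ae ?_
  filter_upwards [exp_llr_of_ac' μ ν hνμ, Measure.rnDeriv_lt_top μ ν] with x hx hlt
  rw [hx, ENNReal.ofReal_toReal hlt.ne]

/-- The density of a product measure is the product of the densities. -/
theorem pi_withDensity_ofReal {ι : Type*} [Fintype ι] {E : ι → Type*}
    [∀ i, MeasurableSpace (E i)] (μ ν : ∀ i, Measure (E i)) [∀ i, IsProbabilityMeasure (μ i)]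
    [∀ i, IsProbabilityMeasure (ν i)] {f : ∀ i, E i → ℝ} (hf0 : ∀ i x, 0 ≤ f i x)
    (hf : ∀ i, Integrable (f i) (μ i))
    (hν : ∀ i, (μ i).withDensity (fun x => ENNReal.ofReal (f i x)) = ν i) :
    (Measure.pi μ).withDensity (fun x => ENNReal.ofReal (∏ i, f i (x i))) = Measure.pi ν := by
  refine (Measure.pi_eq fun s hs => ?_).symm
  have hfs : ∀ i, Integrable (f i) ((μ i).restrict (s i)) := fun i => (hf i).restrict
  rw [withDensity_apply _ (MeasurableSet.univ_pi hs), Measure.restrict_pi_pi,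
    ← ofReal_integral_eq_lintegral_ofReal (Integrable.fintype_prod_dep hfs)
      (Eventually.of_forall fun x => Finset.prod_nonneg fun i _ => hf0 i _),
    integral_fintype_prod_eq_prod,
    ENNReal.ofReal_prod_of_nonneg fun i _ => integral_nonneg (hf0 i)]
  refine Finset.prod_congr rfl fun i _ => ?_
  rw [← hν i, withDensity_apply _ (hs i),
    ofReal_integral_eq_lintegral_ofReal (hfs i) (Eventually.of_forall (hf0 i))]

end Density

section Observations

open ProbabilityTheory

variable {n : ℕ} {X : Fin n → Type*} [∀ j, MeasurableSpace (X j)]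
  {P : Fin 2 → ∀ j, Measure (X j)}

/-- Linear combination of the log-likelihood ratios of all observations of the first `t` rounds;
node `j` has weight `c k j` in the round that lies `k` rounds before the last one. -/
noncomputable def weightedLlr (P : Fin 2 → ∀ j, Measure (X j)) (c : ℕ → Fin n → ℝ) (t : ℕ)
    (x : Fin t → ∀ j, X j) : ℝ :=
  ∑ s : Fin t, ∑ j, c s.rev j * llr (P 1 j) (P 0 j) (x s j)

/-- Cumulant generating function of the total log-likelihood ratio of one round under
hypothesis `0`, written as the sum over the nodes. -/
noncomputable def roundCgf (P : Fin 2 → ∀ j, Measure (X j)) (l : ℝ) : ℝ :=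
  ∑ j, cgf (llr (P 1 j) (P 0 j)) (P 0 j) l

theorem measurable_weightedLlr (c : ℕ → Fin n → ℝ) (t : ℕ) : Measurable (weightedLlr P c t) := by
  unfold weightedLlr
  refine Finset.measurable_sum _ fun s _ => Finset.measurable_sum _ fun j _ => ?_
  exact ((measurable_llr _ _).comp ((measurable_pi_apply j).comp (measurable_pi_apply s))).const_mul
    _

instance [∀ θ j, IsProbabilityMeasure (P θ j)] (θ : Fin 2) (t : ℕ) :
    IsProbabilityMeasure (obsLaw P θ t) := by
  unfold obsLaw; infer_instance

theorem integrable_exp_llr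
    (hmgf : ∀ j (l : ℝ), Integrable (fun x => Real.exp (l * llr (P 1 j) (P 0 j) x)) (P 0 j)) (j : Fin n) :
    Integrable (fun x => Real.exp (llr (P 1 j) (P 0 j) x)) (P 0 j) := by
  simpa using hmgf j 1

variable [∀ θ j, IsProbabilityMeasure (P θ j)]

/-- Hypothesis `1` tilts the observations of each node by the exponential of the log-likelihood
ratio. -/
theorem pi_one_eq_withDensity (hac01 : ∀ j, P 0 j ≪ P 1 j) (hac10 : ∀ j, P 1 j ≪ P 0 j)
    (hmgf : ∀ j (l : ℝ), Integrable (fun x => Real.exp (l * llr (P 1 j) (P 0 j) x)) (P 0 j)) :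
    (Measure.pi (P 0)).withDensity
      (fun x => ENNReal.ofReal (∏ j, Real.exp (llr (P 1 j) (P 0 j) (x j)))) = Measure.pi (P 1) :=
  pi_withDensity_ofReal (P 0) (P 1) (f := fun j x => Real.exp (llr (P 1 j) (P 0 j) x))
    (fun _ _ => (Real.exp_pos _).le) (integrable_exp_llr hmgf)
    fun j => withDensity_exp_llr (hac10 j) (hac01 j)

theorem obsLaw_one_eq_withDensity (hac01 : ∀ j, P 0 j ≪ P 1 j) (hac10 : ∀ j, P 1 j ≪ P 0 j)
    (hmgf : ∀ j (l : ℝ), Integrable (fun x => Real.exp (l * llr (P 1 j) (P 0 j) x)) (P 0 j))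
    (t : ℕ) :
    (obsLaw P 0 t).withDensity
      (fun x => ENNReal.ofReal (Real.exp (weightedLlr P (fun _ _ => 1) t x))) = obsLaw P 1 t := by
  have := pi_withDensity_ofReal (fun _ : Fin t => Measure.pi (P 0))
    (fun _ : Fin t => Measure.pi (P 1))
    (f := fun _ x => ∏ j, Real.exp (llr (P 1 j) (P 0 j) (x j)))
    (fun _ _ => Finset.prod_nonneg fun _ _ => (Real.exp_pos _).le)
    (fun _ => Integrable.fintype_prod_dep (integrable_exp_llr hmgf))
    fun _ => pi_one_eq_withDensity hac01 hac10 hmgf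
  simpa [weightedLlr, Real.exp_sum, obsLaw] using this

/-- Under hypothesis `1`, exponential moments of a log-likelihood ratio are those under
hypothesis `0`, shifted by one. -/
theorem mgf_llr_one {Ω : Type*} [MeasurableSpace Ω] {μ ν : Measure Ω}
    [IsProbabilityMeasure μ] [IsProbabilityMeasure ν] (hμν : μ ≪ ν) (hνμ : ν ≪ μ)
    (hint : ∀ l : ℝ, Integrable (fun x => Real.exp (l * llr μ ν x)) ν) (l : ℝ) :
    Integrable (fun x => Real.exp (l * llr μ ν x)) μ ∧
      mgf (llr μ ν) μ l = mgf (llr μ ν) ν (l + 1) := by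
  have hm : Measurable fun x => Real.exp (llr μ ν x) := (measurable_llr μ ν).exp
  have hmul : ∀ x, Real.exp (llr μ ν x) * Real.exp (l * llr μ ν x) =
      Real.exp ((l + 1) * llr μ ν x) := fun x => by
    rw [← Real.exp_add]; congr 1; ring
  have hd := withDensity_exp_llr hμν hνμ
  constructor
  · rw [← hd, integrable_withDensity_iff_integrable_smul₀' hm.ennreal_ofReal.aemeasurable
      (Eventually.of_forall fun _ => ENNReal.ofReal_lt_top)]
    simpa [ENNReal.toReal_ofReal (Real.exp_pos _).le, hmul, hd] using hint (l + 1)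
  · unfold mgf
    conv_lhs => rw [← hd]
    rw [integral_withDensity_eq_integral_toReal_smul₀ hm.ennreal_ofReal.aemeasurable
      (Eventually.of_forall fun _ => ENNReal.ofReal_lt_top)]
    simp [ENNReal.toReal_ofReal (Real.exp_pos _).le, hmul, hd]

theorem integrable_exp_weightedLlr {θ : Fin 2}
    (hint : ∀ j (l : ℝ), Integrable (fun x => Real.exp (l * llr (P 1 j) (P 0 j) x)) (P θ j))
    (c : ℕ → Fin n → ℝ) (t : ℕ) (l : ℝ) :
    Integrable (fun x => Real.exp (l * weightedLlr P c t x)) (obsLaw P θ t) := by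
  have := Integrable.fintype_prod (μ := fun _ : Fin t => Measure.pi (P θ))
    fun s : Fin t => Integrable.fintype_prod_dep fun j => hint j (l * c s.rev j)
  simpa [weightedLlr, Finset.mul_sum, Real.exp_sum, obsLaw, mul_assoc] using this

theorem log_mgf_weightedLlr {θ : Fin 2}
    (hint : ∀ j (l : ℝ), Integrable (fun x => Real.exp (l * llr (P 1 j) (P 0 j) x)) (P θ j))
    (c : ℕ → Fin n → ℝ) (t : ℕ) (l : ℝ) :
    Real.log (mgf (weightedLlr P c t) (obsLaw P θ t) l) =
      ∑ k ∈ Finset.range t, ∑ j, cgf (llr (P 1 j) (P 0 j)) (P θ j) (l * c k j) := by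
  have hprod : mgf (weightedLlr P c t) (obsLaw P θ t) l =
      ∏ s : Fin t, ∏ j, mgf (llr (P 1 j) (P 0 j)) (P θ j) (l * c s.rev j) := by
    simp only [mgf, weightedLlr, Finset.mul_sum, Real.exp_sum, obsLaw, ← mul_assoc]
    rw [integral_fintype_prod_eq_prod (fun (s : Fin t) (x : ∀ j, X j) =>
      ∏ j, Real.exp (l * c s.rev j * llr (P 1 j) (P 0 j) (x j)))]
    exact Finset.prod_congr rfl fun s _ => integral_fintype_prod_eq_prod
      fun j x => Real.exp (l * c s.rev j * llr (P 1 j) (P 0 j) x)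
  have hpos : ∀ j l, mgf (llr (P 1 j) (P 0 j)) (P θ j) l ≠ 0 := fun j l =>
    (mgf_pos (hint j l)).ne'
  rw [hprod, Real.log_prod fun s _ => Finset.prod_ne_zero_iff.2 fun j _ => hpos j _,
    ← Fin.sum_univ_eq_sum_range (fun k => ∑ j, cgf (llr (P 1 j) (P 0 j)) (P θ j) (l * c k j)),
    ← Equiv.sum_comp Fin.revPerm]
  refine Finset.sum_congr rfl fun s _ => ?_
  rw [Real.log_prod fun j _ => hpos j _]
  simp [cgf]

/-- When the weights tend to one, the normalised cumulant generating functions converge: they are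
Cesàro means of cumulant generating functions of single rounds. -/
theorem tendsto_log_mgf_weightedLlr {θ : Fin 2}
    (hint : ∀ j (l : ℝ), Integrable (fun x => Real.exp (l * llr (P 1 j) (P 0 j) x)) (P θ j))
    {c : ℕ → Fin n → ℝ} (hc : ∀ j, Tendsto (fun k => c k j) atTop (𝓝 1)) (l : ℝ) :
    Tendsto (fun t : ℕ => (1 / (t : ℝ)) *
      Real.log (mgf (weightedLlr P c t) (obsLaw P θ t) l)) atTop
      (𝓝 (∑ j, cgf (llr (P 1 j) (P 0 j)) (P θ j) l)) := by
  simp only [log_mgf_weightedLlr hint, one_div]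
  refine Tendsto.cesaro (tendsto_finsetSum _ fun j _ => ?_)
  have hcont : Continuous fun l => cgf (llr (P 1 j) (P 0 j)) (P θ j) l :=
    (continuous_mgf (hint j)).log fun l => (mgf_pos (hint j l)).ne'
  have := (hc j).const_mul l
  rw [mul_one] at this
  exact (hcont.tendsto l).comp this

end Observations

/-! ### The minimiser of the cumulant generating function and the Chernoff information -/

section Chernoff

open ProbabilityTheory

theorem strictConvexOn_mgf {Ω : Type*} [MeasurableSpace Ω] {μ : Measure Ω} {Y : Ω → ℝ}
    (hint : ∀ l, Integrable (fun x => Real.exp (l * Y x)) μ) (hY : ¬ Y =ᵐ[μ] 0) :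
    StrictConvexOn ℝ Set.univ (mgf Y μ) := by
  refine ⟨convex_univ, fun a _ b _ hab p q hp hq hpq => ?_⟩
  have hg : Integrable (fun x => p * Real.exp (a * Y x) + q * Real.exp (b * Y x) -
      Real.exp ((p * a + q * b) * Y x)) μ :=
    (((hint a).const_mul p).add ((hint b).const_mul q)).sub (hint _)
  have hconv : ∀ x, Real.exp ((p * a + q * b) * Y x) ≤
      p * Real.exp (a * Y x) + q * Real.exp (b * Y x) := fun x => by
    have := convexOn_exp.2 (Set.mem_univ (a * Y x)) (Set.mem_univ (b * Y x)) hp.le hq.le hpq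
    simp only [smul_eq_mul] at this
    rwa [← mul_assoc, ← mul_assoc, ← add_mul] at this
  have hpos : 0 < ∫ x, (p * Real.exp (a * Y x) + q * Real.exp (b * Y x) -
      Real.exp ((p * a + q * b) * Y x)) ∂μ := by
    refine (integral_pos_iff_support_of_nonneg (fun x => sub_nonneg.2 (hconv x)) hg).2 ?_
    refine pos_iff_ne_zero.2 fun h0 => hY ?_
    refine ae_iff.2 (measure_mono_null (fun x hx => ?_) h0)
    have hx : Y x ≠ 0 := hx
    have := strictConvexOn_exp.2 (Set.mem_univ (a * Y x)) (Set.mem_univ (b * Y x))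
      (fun h => hab (mul_right_cancel₀ hx h)) hp hq hpq
    simp only [smul_eq_mul] at this
    rw [← mul_assoc, ← mul_assoc, ← add_mul] at this
    exact Function.mem_support.2 (sub_pos.2 this).ne'
  have hab' : Integrable (fun x => p * Real.exp (a * Y x) + q * Real.exp (b * Y x)) μ :=
    ((hint a).const_mul p).add ((hint b).const_mul q)
  rw [integral_sub hab' (hint _), integral_add ((hint a).const_mul p) ((hint b).const_mul q),
    integral_const_mul, integral_const_mul, sub_pos] at hpos
  exact hpos

/-- A strictly convex function on the line with equal values at `0` and `1` has its unique
minimiser strictly between them. -/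
theorem exists_strict_minimizer {f : ℝ → ℝ} (hf : StrictConvexOn ℝ Set.univ f)
    (hc : Continuous f) (h01 : f 0 = f 1) :
    ∃ a, 0 < a ∧ a < 1 ∧ IsLocalMin f a ∧ ∀ b, b ≠ a → f a < f b := by
  obtain ⟨a, ha, hmin⟩ := isCompact_Icc.exists_isMinOn
    (Set.nonempty_Icc.2 (zero_le_one (α := ℝ))) hc.continuousOn
  have hhalf : f (1 / 2) < f 0 := by
    have := hf.2 (Set.mem_univ 0) (Set.mem_univ 1) zero_ne_one (half_pos one_pos)
      (half_pos one_pos) (add_halves 1)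
    simpa [smul_eq_mul, ← h01, ← two_mul] using this
  have hle : f a ≤ f (1 / 2) := hmin (by norm_num)
  have ha0 : a ≠ 0 := by rintro rfl; linarith
  have ha1 : a ≠ 1 := by rintro rfl; linarith
  have hlt : 0 < a ∧ a < 1 := ⟨lt_of_le_of_ne ha.1 ha0.symm, lt_of_le_of_ne ha.2 ha1⟩
  have hloc : IsLocalMin f a := hmin.isLocalMin (Icc_mem_nhds hlt.1 hlt.2)
  have hglob := IsMinOn.of_isLocalMin_of_convex_univ hloc hf.convexOn
  refine ⟨a, hlt.1, hlt.2, hloc, fun b hb => lt_of_le_of_ne (hglob b) fun h => hb ?_⟩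
  refine hf.eq_of_isMinOn (fun x _ => ?_) (fun x _ => hglob x) (Set.mem_univ b) (Set.mem_univ a)
  exact h.symm.trans_le (hglob x)

variable {n : ℕ} {X : Fin n → Type*} [∀ j, MeasurableSpace (X j)]
  {P : Fin 2 → ∀ j, Measure (X j)} [∀ θ j, IsProbabilityMeasure (P θ j)]

/-- The Chernoff information is minus the minimum of the cumulant generating function, which is
attained at a unique point, strictly between `0` and `1`. -/
theorem exists_roundCgf_minimizer (hac01 : ∀ j, P 0 j ≪ P 1 j) (hac10 : ∀ j, P 1 j ≪ P 0 j)
    (hmgf : ∀ j (l : ℝ), Integrable (fun x => Real.exp (l * llr (P 1 j) (P 0 j) x)) (P 0 j))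
    (hne : ∃ j, P 0 j ≠ P 1 j) :
    ∃ l₀, 0 < l₀ ∧ l₀ < 1 ∧ HasDerivAt (roundCgf P) 0 l₀ ∧
      (∀ l, l ≠ l₀ → roundCgf P l₀ < roundCgf P l) ∧
      chernoffInformation (Measure.pi (P 0)) (Measure.pi (P 1)) = -roundCgf P l₀ := by
  set Q := Measure.pi (P 0) with hQ
  let Y : (∀ j, X j) → ℝ := fun x => ∑ j, llr (P 1 j) (P 0 j) (x j)
  have hdens : Q.withDensity (fun x => ENNReal.ofReal (Real.exp (Y x))) = Measure.pi (P 1) := by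
    simpa [Y, Real.exp_sum] using pi_one_eq_withDensity hac01 hac10 hmgf
  have hYm : Measurable Y := Finset.measurable_sum _ fun j _ =>
    (measurable_llr _ _).comp (measurable_pi_apply j)
  have hint : ∀ l, Integrable (fun x => Real.exp (l * Y x)) Q := fun l => by
    simpa [Y, Finset.mul_sum, Real.exp_sum] using Integrable.fintype_prod_dep fun j => hmgf j l
  have hpos : ∀ l, 0 < mgf Y Q l := fun l => mgf_pos (hint l)
  have hcgf : roundCgf P = fun l => Real.log (mgf Y Q l) := by
    funext l
    have : mgf Y Q l = ∏ j, mgf (llr (P 1 j) (P 0 j)) (P 0 j) l := by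
      simp only [mgf, Y, Finset.mul_sum, Real.exp_sum]
      exact integral_fintype_prod_eq_prod fun j x => Real.exp (l * llr (P 1 j) (P 0 j) x)
    rw [this, Real.log_prod fun j _ => (mgf_pos (hmgf j l)).ne']
    rfl
  -- A vanishing total log-likelihood ratio would make the two joint laws equal.
  have hY : ¬ Y =ᵐ[Q] 0 := fun h => by
    have heq : Q = Measure.pi (P 1) := by
      have hone : (fun x => ENNReal.ofReal (Real.exp (Y x))) =ᵐ[Q] 1 :=
        h.mono fun x hx => by simp [hx]
      rw [← hdens, withDensity_congr_ae hone, withDensity_one]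
    obtain ⟨j, hj⟩ := hne
    exact hj (((measurePreserving_eval (P 0) j).map_eq.symm.trans
      (congrArg (fun ρ => ρ.map (Function.eval j)) heq)).trans
      (measurePreserving_eval (P 1) j).map_eq)
  have h0 : mgf Y Q 0 = 1 := mgf_zero
  have h1 : mgf Y Q 1 = 1 := by
    have : ∫⁻ x, ENNReal.ofReal (Real.exp (Y x)) ∂Q = 1 := by
      rw [← setLIntegral_univ, ← withDensity_apply _ MeasurableSet.univ, hdens, measure_univ]
    rw [mgf, integral_eq_lintegral_of_nonneg_ae
      (Eventually.of_forall fun _ => (Real.exp_pos _).le) (hint 1).1]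
    simp [this]
  obtain ⟨a, ha0, ha1, hloc, hmin⟩ := exists_strict_minimizer (strictConvexOn_mgf hint hY)
    (continuous_mgf hint) (h0.trans h1.symm)
  have hmin' : ∀ l, l ≠ a → roundCgf P a < roundCgf P l := fun l hl => by
    rw [hcgf]
    exact Real.log_lt_log (hpos a) (hmin l hl)
  refine ⟨a, ha0, ha1, ?_, hmin', ?_⟩
  · have hd : DifferentiableAt ℝ (mgf Y Q) a := differentiableAt_mgf (by
      rw [show integrableExpSet Y Q = Set.univ from Set.eq_univ_of_forall hint, interior_univ]
      exact Set.mem_univ a)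
    have := hd.hasDerivAt
    rw [hloc.deriv_eq_zero] at this
    rw [hcgf]
    simpa using this.log (hpos a).ne'
  · have himage : ∀ l, ∫ x, ((Measure.pi (P 1)).rnDeriv Q x).toReal ^ l ∂Q = mgf Y Q l := by
      intro l
      have hrn : (Measure.pi (P 1)).rnDeriv Q =ᵐ[Q] fun x => ENNReal.ofReal (Real.exp (Y x)) := by
        rw [← hdens]
        exact Measure.rnDeriv_withDensity Q hYm.exp.ennreal_ofReal
      refine integral_congr_ae ?_
      filter_upwards [hrn] with x hx
      rw [hx, ENNReal.toReal_ofReal (Real.exp_pos _).le, ← Real.exp_mul, mul_comm]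
    unfold chernoffInformation
    refine IsGreatest.csSup_eq ⟨⟨a, ⟨ha0.le, ha1.le⟩, ?_⟩, ?_⟩
    · simp only [himage, hcgf]
    · rintro _ ⟨l, -, rfl⟩
      simp only [himage]
      have := congrFun hcgf l
      rcases eq_or_ne l a with rfl | hl
      · rw [this]
      · rw [← this]
        exact neg_le_neg (hmin' l hl).le

end Chernoff

/-! ### Beliefs as weighted log-likelihood ratios -/

section Belief

variable {n : ℕ} {X : Fin n → Type*} [∀ j, MeasurableSpace (X j)]
  {P : Fin 2 → ∀ j, Measure (X j)} {W : Matrix (Fin n) (Fin n) ℝ} {r : Fin n → ℝ}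

/-- An observation of node `j` at which both likelihoods are positive and the logarithm of their
quotient is the log-likelihood ratio. -/
def IsRegularObs (P : Fin 2 → ∀ j, Measure (X j)) (j : Fin n) (x : X j) : Prop :=
  (∀ θ, 0 < likelihood P j θ x) ∧
    Real.log (likelihood P j 1 x / likelihood P j 0 x) = llr (P 1 j) (P 0 j) x

theorem log_localUpdate_div {q : Fin n → Fin 2 → ℝ} (hq : ∀ j θ, 0 < q j θ) {x : ∀ j, X j}
    (hx : ∀ j, IsRegularObs P j (x j)) (j : Fin n) :
    (∀ θ, 0 < localUpdate P r q x j θ) ∧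
      Real.log (localUpdate P r q x j 1 / localUpdate P r q x j 0) =
        Real.log (q j 1 / q j 0) + r j * llr (P 1 j) (P 0 j) (x j) := by
  have hlik := (hx j).1
  have hpos : ∀ θ, 0 < q j θ * likelihood P j θ (x j) ^ r j := fun θ =>
    mul_pos (hq j θ) (Real.rpow_pos_of_pos (hlik θ) _)
  have hsum : 0 < ∑ θ, q j θ * likelihood P j θ (x j) ^ r j :=
    Finset.sum_pos (fun θ _ => hpos θ) Finset.univ_nonempty
  refine ⟨fun θ => div_pos (hpos θ) hsum, ?_⟩
  rw [← (hx j).2, localUpdate, localUpdate, div_div_div_cancel_right₀ hsum.ne', mul_div_mul_comm,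
    ← Real.div_rpow (hlik 1).le (hlik 0).le,
    Real.log_mul (div_pos (hq j 1) (hq j 0)).ne'
      (Real.rpow_pos_of_pos (div_pos (hlik 1) (hlik 0)) _).ne',
    Real.log_rpow (div_pos (hlik 1) (hlik 0))]

theorem log_geomAverage_div {b : Fin n → Fin 2 → ℝ} (hb : ∀ j θ, 0 < b j θ) (i : Fin n) :
    (∀ θ, 0 < geomAverage W b i θ) ∧
      Real.log (geomAverage W b i 1 / geomAverage W b i 0) =
        ∑ j, W i j * Real.log (b j 1 / b j 0) := by
  have hpos : ∀ θ, 0 < ∏ j, b j θ ^ W i j := fun θ =>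
    Finset.prod_pos fun j _ => Real.rpow_pos_of_pos (hb j θ) _
  have hsum : 0 < ∑ θ, ∏ j, b j θ ^ W i j :=
    Finset.sum_pos (fun θ _ => hpos θ) Finset.univ_nonempty
  refine ⟨fun θ => div_pos (hpos θ) hsum, ?_⟩
  rw [geomAverage, geomAverage, div_div_div_cancel_right₀ hsum.ne', ← Finset.prod_div_distrib,
    Real.log_prod fun j _ => (div_pos (Real.rpow_pos_of_pos (hb j 1) _)
      (Real.rpow_pos_of_pos (hb j 0) _)).ne']
  refine Finset.sum_congr rfl fun j _ => ?_
  rw [← Real.div_rpow (hb j 1).le (hb j 0).le, Real.log_rpow (div_pos (hb j 1) (hb j 0))]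

/-- In log-belief ratios both updates are linear, so an observation made `k` rounds before the
last one has passed through `k + 1` consensus steps. -/
theorem logBeliefRatio_eq_weightedLlr (t : ℕ) {x : Fin t → ∀ j, X j}
    (hx : ∀ s j, IsRegularObs P j (x s j)) (i : Fin n) :
    (∀ θ, 0 < belief W P r t x i θ) ∧
      logBeliefRatio W P r i t x = weightedLlr P (fun k j => (W ^ (k + 1)) i j * r j) t x := by
  induction t generalizing i with
  | zero => simp [belief, logBeliefRatio, weightedLlr]
  | succ t ih =>
    have ih' := fun j => ih (x := fun s => x s.castSucc) (fun s => hx s.castSucc) j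
    have hloc := log_localUpdate_div (r := r) (fun j θ => (ih' j).1 θ) (hx (Fin.last t))
    have hgeo := log_geomAverage_div (W := W) (fun j θ => (hloc j).1 θ) i
    refine ⟨hgeo.1, hgeo.2.trans ?_⟩
    simp only [(hloc _).2]
    have hrec : ∀ j, Real.log (belief W P r t (fun s => x s.castSucc) j 1 /
        belief W P r t (fun s => x s.castSucc) j 0) =
        ∑ s : Fin t, ∑ k, (W ^ (s.rev.val + 1)) j k * r k *
          llr (P 1 k) (P 0 k) (x s.castSucc k) := fun j => (ih' j).2
    simp only [hrec, weightedLlr, Fin.sum_univ_castSucc, Fin.rev_castSucc, Fin.rev_last,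
      Fin.val_succ, Fin.val_zero, zero_add, pow_one, mul_add, Finset.sum_add_distrib]
    congr 1
    · simp only [Finset.mul_sum]
      rw [Finset.sum_comm]
      refine Finset.sum_congr rfl fun s _ => ?_
      rw [Finset.sum_comm]
      refine Finset.sum_congr rfl fun k _ => ?_
      rw [pow_succ' W (s.rev.val + 1), Matrix.mul_apply]
      simp only [Finset.sum_mul, mul_assoc]
    · simp only [mul_assoc]

theorem measurable_likelihood (j : Fin n) (θ : Fin 2) : Measurable (likelihood P j θ) :=
  (Measure.measurable_rnDeriv _ _).ennreal_toReal

theorem measurable_belief (t : ℕ) (i : Fin n) (θ : Fin 2) :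
    Measurable fun x => belief W P r t x i θ := by
  induction t generalizing i θ with
  | zero => exact measurable_const
  | succ t ih =>
    have hnum : ∀ (j : Fin n) (θ : Fin 2), Measurable fun x : Fin (t + 1) → ∀ j, X j =>
        belief W P r t (fun s => x s.castSucc) j θ *
          likelihood P j θ (x (Fin.last t) j) ^ r j := fun j θ =>
      ((ih j θ).comp (measurable_pi_lambda _ fun s => measurable_pi_apply s.castSucc)).mul
        (((measurable_likelihood j θ).comp
          ((measurable_pi_apply j).comp (measurable_pi_apply (Fin.last t)))).pow_const _)
    have hloc : ∀ (j : Fin n) (θ : Fin 2), Measurable fun x : Fin (t + 1) → ∀ j, X j =>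
        localUpdate P r (belief W P r t fun s => x s.castSucc) (x (Fin.last t)) j θ :=
      fun j θ => (hnum j θ).div (Finset.measurable_sum _ fun θ' _ => hnum j θ')
    have hprod : ∀ θ : Fin 2, Measurable fun x : Fin (t + 1) → ∀ j, X j =>
        ∏ j, localUpdate P r (belief W P r t fun s => x s.castSucc) (x (Fin.last t)) j θ ^
          W i j :=
      fun θ => Finset.measurable_prod _ fun j _ => (hloc j θ).pow_const _
    exact (hprod θ).div (Finset.measurable_sum _ fun θ' _ => hprod θ')

theorem measurable_logBeliefRatio (i : Fin n) (t : ℕ) : Measurable (logBeliefRatio W P r i t) :=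
  ((measurable_belief t i 1).div (measurable_belief t i 0)).log

theorem measurable_lbrTest (γ η : ℝ) (i : Fin n) (t : ℕ) :
    Measurable (lbrTest W P r γ η i t) :=
  Measurable.ite (measurableSet_lt measurable_const (measurable_logBeliefRatio i t))
    measurable_const (Measurable.ite
      (measurableSet_eq_fun (measurable_logBeliefRatio i t) measurable_const)
      measurable_const measurable_const)

theorem lbrTest_mem_Icc {η : ℝ} (hη : η ∈ Set.Icc (0 : ℝ) 1) (γ : ℝ) (i : Fin n) (t : ℕ)
    (x : Fin t → ∀ j, X j) : lbrTest W P r γ η i t x ∈ Set.Icc (0 : ℝ) 1 := by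
  unfold lbrTest thresholdRule
  split_ifs <;> first | exact hη | simp

variable [∀ θ j, IsProbabilityMeasure (P θ j)]

theorem ae_isRegularObs (hac01 : ∀ j, P 0 j ≪ P 1 j) (hac10 : ∀ j, P 1 j ≪ P 0 j) (j : Fin n)
    (θ : Fin 2) : ∀ᵐ x ∂P θ j, IsRegularObs P j x := by
  -- It suffices to consider one hypothesis, by mutual absolute continuity.
  suffices h : ∀ᵐ x ∂P 0 j, IsRegularObs P j x by
    fin_cases θ
    · exact h
    · exact (hac10 j).ae_le h
  have h0 : P 0 j ≪ P 0 j + P 1 j := Measure.AbsolutelyContinuous.rfl.add_right _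
  have h1 : P 1 j ≪ P 0 j + P 1 j := (hac10 j).trans h0
  filter_upwards [Measure.rnDeriv_pos h0, (hac01 j).ae_le (Measure.rnDeriv_pos h1),
    h0.ae_le (Measure.rnDeriv_lt_top (P 0 j) (P 0 j + P 1 j)),
    h0.ae_le (Measure.rnDeriv_lt_top (P 1 j) (P 0 j + P 1 j)),
    h0.ae_le (Measure.rnDeriv_mul_rnDeriv (κ := P 0 j + P 1 j) (hac10 j))]
    with x hp0 hp1 ht0 ht1 hmul
  have hpos0 : 0 < likelihood P j 0 x := ENNReal.toReal_pos hp0.ne' ht0.ne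
  refine ⟨Fin.forall_fin_two.2 ⟨hpos0, ENNReal.toReal_pos hp1.ne' ht1.ne⟩, ?_⟩
  have : likelihood P j 1 x = ((P 1 j).rnDeriv (P 0 j) x).toReal * likelihood P j 0 x := by
    rw [likelihood, likelihood, ← hmul, Pi.mul_apply, ENNReal.toReal_mul]
  rw [this, mul_div_cancel_right₀ _ hpos0.ne', llr]

theorem ae_logBeliefRatio_eq (hac01 : ∀ j, P 0 j ≪ P 1 j) (hac10 : ∀ j, P 1 j ≪ P 0 j)
    (θ : Fin 2) (i : Fin n) (t : ℕ) :
    ∀ᵐ x ∂obsLaw P θ t,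
      logBeliefRatio W P r i t x = weightedLlr P (fun k j => (W ^ (k + 1)) i j * r j) t x := by
  have hreg : ∀ᵐ x ∂obsLaw P θ t, ∀ s j, IsRegularObs P j (x s j) := by
    refine eventually_all.2 fun s => ?_
    refine (Measure.quasiMeasurePreserving_eval (fun _ : Fin t => Measure.pi (P θ)) s).ae
      (p := fun y => ∀ j, IsRegularObs P j (y j)) ?_
    exact eventually_all.2 fun j => (Measure.quasiMeasurePreserving_eval (P θ) j).ae
      (ae_isRegularObs hac01 hac10 j θ)
  exact hreg.mono fun x hx => (logBeliefRatio_eq_weightedLlr t hx i).2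

end Belief

/-! ### Error exponents and Bayes risks -/

section Risk

variable {n : ℕ} {X : Fin n → Type*} [∀ j, MeasurableSpace (X j)]
  {P : Fin 2 → ∀ j, Measure (X j)} [∀ θ j, IsProbabilityMeasure (P θ j)]
  {W : Matrix (Fin n) (Fin n) ℝ}

/-- The error probability of a test that decides by the sign of `S`, whatever it does on ties. -/
theorem measureReal_le_integral_le {Ω : Type*} [MeasurableSpace Ω] {μ : Measure Ω}
    [IsProbabilityMeasure μ] {S φ : Ω → ℝ} (hS : Measurable S) (hφ : Measurable φ)
    (h01 : ∀ x, φ x ∈ Set.Icc (0 : ℝ) 1) (hpos : ∀ᵐ x ∂μ, 0 < S x → φ x = 1)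
    (hneg : ∀ᵐ x ∂μ, S x < 0 → φ x = 0) :
    μ.real {x | 0 < S x} ≤ ∫ x, φ x ∂μ ∧ ∫ x, φ x ∂μ ≤ μ.real {x | 0 ≤ S x} := by
  have hint : Integrable φ μ := Integrable.of_mem_Icc 0 1 hφ.aemeasurable
    (Eventually.of_forall h01)
  have hm : MeasurableSet {x | 0 < S x} := measurableSet_lt measurable_const hS
  have hm' : MeasurableSet {x | 0 ≤ S x} := measurableSet_le measurable_const hS
  rw [← integral_indicator_one hm, ← integral_indicator_one hm']
  constructor
  · refine integral_mono_ae ((integrable_const 1).indicator hm) hint ?_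
    filter_upwards [hpos] with x hx
    by_cases h : 0 < S x
    · rw [Set.indicator_of_mem (s := {x | 0 < S x}) h, hx h, Pi.one_apply]
    · rw [Set.indicator_of_notMem (s := {x | 0 < S x}) h]
      exact (h01 x).1
  · refine integral_mono_ae hint ((integrable_const 1).indicator hm') ?_
    filter_upwards [hneg] with x hx
    by_cases h : 0 ≤ S x
    · rw [Set.indicator_of_mem (s := {x | 0 ≤ S x}) h]
      exact (h01 x).2
    · rw [Set.indicator_of_notMem (s := {x | 0 ≤ S x}) h, hx (not_le.1 h)]

/-- Weighted log-likelihood ratios whose weights tend to one cross zero, in the wrong direction,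
with the Chernoff information as exponent under either hypothesis. Under hypothesis `1` the sign
is reversed and the limiting cumulant generating function becomes `roundCgf P (1 - l)`. -/
theorem hasExponent_of_weightedLlr (hac01 : ∀ j, P 0 j ≪ P 1 j) (hac10 : ∀ j, P 1 j ≪ P 0 j)
    (hmgf : ∀ j (l : ℝ), Integrable (fun x => Real.exp (l * llr (P 1 j) (P 0 j) x)) (P 0 j))
    (hne : ∃ j, P 0 j ≠ P 1 j) {c : ℕ → Fin n → ℝ}
    (hc : ∀ j, Tendsto (fun k => c k j) atTop (𝓝 1)) {e : ℕ → ℝ} :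
    ((∀ t, (obsLaw P 0 t).real {x | 0 < weightedLlr P c t x} ≤ e t ∧
        e t ≤ (obsLaw P 0 t).real {x | 0 ≤ weightedLlr P c t x}) →
      HasExponent e (chernoffInformation (Measure.pi (P 0)) (Measure.pi (P 1)))) ∧
    ((∀ t, (obsLaw P 1 t).real {x | 0 < -weightedLlr P c t x} ≤ e t ∧
        e t ≤ (obsLaw P 1 t).real {x | 0 ≤ -weightedLlr P c t x}) →
      HasExponent e (chernoffInformation (Measure.pi (P 0)) (Measure.pi (P 1)))) := by
  obtain ⟨l₀, h0, h1, hder, hmin, hCI⟩ := exists_roundCgf_minimizer hac01 hac10 hmgf hne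
  rw [hCI]
  constructor <;> intro he
  · exact hasExponent_of_tendsto_log_mgf (measurable_weightedLlr c)
      (integrable_exp_weightedLlr hmgf c) (tendsto_log_mgf_weightedLlr hmgf hc) h0 hder
      (fun l hl => hmin l hl.ne') (fun t => (he t).1) fun t => (he t).2
  · have hone := fun j => mgf_llr_one (hac10 j) (hac01 j) (hmgf j)
    have hmgf' : ∀ j (l : ℝ),
        Integrable (fun x => Real.exp (l * llr (P 1 j) (P 0 j) x)) (P 1 j) :=
      fun j l => (hone j l).1
    have hΛ : ∀ l, ∑ j, ProbabilityTheory.cgf (llr (P 1 j) (P 0 j)) (P 1 j) (-l) =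
        roundCgf P (1 - l) := fun l => by
      refine Finset.sum_congr rfl fun j _ => ?_
      rw [ProbabilityTheory.cgf, (hone j _).2, neg_add_eq_sub, ProbabilityTheory.cgf]
    have hder' : HasDerivAt (fun l => roundCgf P (1 - l)) 0 (1 - l₀) := by
      have h := HasDerivAt.comp_const_sub (f := roundCgf P) (f' := 0) 1 (1 - l₀)
        (by rwa [sub_sub_cancel])
      rwa [neg_zero] at h
    have hres := hasExponent_of_tendsto_log_mgf (e := e) (μ := fun t => obsLaw P 1 t)
      (S := fun t x => -weightedLlr P c t x) (Λ := fun l => roundCgf P (1 - l)) (l₀ := 1 - l₀)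
      (fun t => (measurable_weightedLlr c t).neg)
      (fun t l => by simpa using integrable_exp_weightedLlr hmgf' c t (-l))
      (fun l => by
        have h := tendsto_log_mgf_weightedLlr hmgf' hc (-l)
        rw [hΛ] at h
        have hneg : ∀ t, ProbabilityTheory.mgf (fun x => -weightedLlr P c t x) (obsLaw P 1 t) l =
            ProbabilityTheory.mgf (weightedLlr P c t) (obsLaw P 1 t) (-l) := fun t =>
          ProbabilityTheory.mgf_neg
        simpa only [hneg] using h)
      (by linarith) hder'
      (fun l hl => by
        rw [sub_sub_cancel]
        exact hmin _ fun h => by linarith)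
      (fun t => (he t).1) fun t => (he t).2
    simpa only [sub_sub_cancel] using hres

/-- Weights `π⁻¹` compensate for the stationary distribution, so that every node weighs the
observations of a distant round as the centralised test does. -/
theorem hasExponent_typeI_typeII (hac01 : ∀ j, P 0 j ≪ P 1 j) (hac10 : ∀ j, P 1 j ≪ P 0 j)
    (hmgf : ∀ j (l : ℝ), Integrable (fun x => Real.exp (l * llr (P 1 j) (P 0 j) x)) (P 0 j))
    (hne : ∃ j, P 0 j ≠ P 1 j) (hW : IsErgodicWeight W) {π : Fin n → ℝ} (hπ : IsStationary W π)
    (i : Fin n) {η : ℕ → ℝ} (hη : ∀ t, η t ∈ Set.Icc (0 : ℝ) 1) :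
    HasExponent (fun t => typeI P t (lbrTest W P (fun j => (π j)⁻¹) 0 (η t) i t))
      (chernoffInformation (Measure.pi (P 0)) (Measure.pi (P 1))) ∧
    HasExponent (fun t => typeII P t (lbrTest W P (fun j => (π j)⁻¹) 0 (η t) i t))
      (chernoffInformation (Measure.pi (P 0)) (Measure.pi (P 1))) := by
  have hc : ∀ j, Tendsto (fun k => (W ^ (k + 1)) i j * (π j)⁻¹) atTop (𝓝 1) := fun j => by
    have h := ((tendsto_add_atTop_iff_nat 1).2 (tendsto_pow_apply hW hπ i j)).mul_const (π j)⁻¹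
    rwa [mul_inv_cancel₀ (hπ.pos hW j).ne'] at h
  have hmem := fun t => lbrTest_mem_Icc (W := W) (P := P) (r := fun j => (π j)⁻¹) (hη t) 0 i t
  constructor
  · refine (hasExponent_of_weightedLlr hac01 hac10 hmgf hne hc).1 fun t => ?_
    have hae := ae_logBeliefRatio_eq (W := W) (r := fun j => (π j)⁻¹) hac01 hac10 0 i t
    refine measureReal_le_integral_le (measurable_weightedLlr _ t)
      (measurable_lbrTest 0 (η t) i t) (hmem t) ?_ ?_
    · filter_upwards [hae] with x hx h
      rw [← hx] at h
      simp [lbrTest, thresholdRule, h]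
    · filter_upwards [hae] with x hx h
      rw [← hx] at h
      simp [lbrTest, thresholdRule, h.not_gt, h.ne]
  · refine (hasExponent_of_weightedLlr hac01 hac10 hmgf hne hc).2 fun t => ?_
    have hae := ae_logBeliefRatio_eq (W := W) (r := fun j => (π j)⁻¹) hac01 hac10 1 i t
    refine measureReal_le_integral_le (measurable_weightedLlr _ t).neg
      (measurable_const.sub (measurable_lbrTest 0 (η t) i t))
      (fun x => ⟨sub_nonneg.2 (hmem t x).2, sub_le_self _ (hmem t x).1⟩) ?_ ?_
    · filter_upwards [hae] with x hx h
      rw [← hx, neg_pos] at h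
      simp [lbrTest, thresholdRule, h.not_gt, h.ne]
    · filter_upwards [hae] with x hx h
      rw [← hx, neg_lt_zero] at h
      simp [lbrTest, thresholdRule, h]

/-- Converse for every test. Where the total log-likelihood ratio `S` is positive, the density
`exp S` of hypothesis `1` exceeds one, so either decision costs at least
`min (ξ 0) (ξ 1)` times the law of the observations under hypothesis `0`. -/
theorem min_mul_measureReal_le_bayesRisk (hac01 : ∀ j, P 0 j ≪ P 1 j)
    (hac10 : ∀ j, P 1 j ≪ P 0 j)
    (hmgf : ∀ j (l : ℝ), Integrable (fun x => Real.exp (l * llr (P 1 j) (P 0 j) x)) (P 0 j))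
    {ξ : Fin 2 → ℝ} (hξ : ∀ θ, 0 < ξ θ) {t : ℕ} {φ : (Fin t → ∀ j, X j) → ℝ}
    (hφ : Measurable φ) (h01 : ∀ x, φ x ∈ Set.Icc (0 : ℝ) 1) :
    min (ξ 0) (ξ 1) * (obsLaw P 0 t).real {x | 0 < weightedLlr P (fun _ _ => 1) t x} ≤
      bayesRisk P ξ t φ := by
  set S := weightedLlr P (fun _ _ => 1) t
  have hSm : Measurable S := measurable_weightedLlr _ t
  have hm : MeasurableSet {x | 0 < S x} := measurableSet_lt measurable_const hSm
  have hint : Integrable φ (obsLaw P 0 t) :=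
    Integrable.of_mem_Icc 0 1 hφ.aemeasurable (Eventually.of_forall h01)
  have hexp : Integrable (fun x => Real.exp (S x)) (obsLaw P 0 t) := by
    simpa using integrable_exp_weightedLlr hmgf (fun _ _ => 1) t 1
  have hint1 : Integrable (fun x => Real.exp (S x) * (1 - φ x)) (obsLaw P 0 t) :=
    hexp.mul_bdd (c := 1) (measurable_const.sub hφ).aestronglyMeasurable
      (Eventually.of_forall fun x => by
        rw [Real.norm_of_nonneg (sub_nonneg.2 (h01 x).2)]
        exact sub_le_self _ (h01 x).1)
  have htypeII : typeII P t φ = ∫ x, Real.exp (S x) * (1 - φ x) ∂obsLaw P 0 t := by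
    rw [typeII, ← obsLaw_one_eq_withDensity hac01 hac10 hmgf t,
      integral_withDensity_eq_integral_toReal_smul₀ hSm.exp.ennreal_ofReal.aemeasurable
        (Eventually.of_forall fun _ => ENNReal.ofReal_lt_top)]
    simp [ENNReal.toReal_ofReal (Real.exp_pos _).le, S]
  rw [bayesRisk, typeI, htypeII, ← integral_const_mul, ← integral_const_mul,
    ← integral_add (hint.const_mul _) (hint1.const_mul _), ← integral_indicator_one hm,
    ← integral_const_mul]
  refine integral_mono (((integrable_const 1).indicator hm).const_mul _)
    ((hint.const_mul _).add (hint1.const_mul _)) fun x => ?_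
  obtain ⟨hx0, hx1⟩ := h01 x
  dsimp only
  by_cases h : 0 < S x
  · rw [Set.indicator_of_mem (s := {x | 0 < S x}) h, Pi.one_apply, mul_one]
    have h1 : 1 ≤ Real.exp (S x) := Real.one_le_exp h.le
    calc min (ξ 0) (ξ 1) = min (ξ 0) (ξ 1) * φ x + min (ξ 0) (ξ 1) * (1 - φ x) := by ring
      _ ≤ ξ 0 * φ x + ξ 1 * (1 - φ x) := add_le_add
          (mul_le_mul_of_nonneg_right (min_le_left _ _) hx0)
          (mul_le_mul_of_nonneg_right (min_le_right _ _) (sub_nonneg.2 hx1))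
      _ ≤ ξ 0 * φ x + ξ 1 * (Real.exp (S x) * (1 - φ x)) := by
          refine add_le_add_right (mul_le_mul_of_nonneg_left ?_ (hξ 1).le) _
          exact le_mul_of_one_le_left (sub_nonneg.2 hx1) h1
  · rw [Set.indicator_of_notMem (s := {x | 0 < S x}) h, mul_zero]
    exact add_nonneg (mul_nonneg (hξ 0).le hx0) (mul_nonneg (hξ 1).le
      (mul_nonneg (Real.exp_pos _).le (sub_nonneg.2 hx1)))

end Risk

end SocialHT

theorem mainTheorem2 {n : ℕ} {X : Fin n → Type*} [∀ j, MeasurableSpace (X j)]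
    (P : Fin 2 → ∀ j, Measure (X j)) [∀ θ j, IsProbabilityMeasure (P θ j)]
    (hac01 : ∀ j, P 0 j ≪ P 1 j) (hac10 : ∀ j, P 1 j ≪ P 0 j)
    (hmgf : ∀ j (l : ℝ), Integrable (fun x => Real.exp (l * llr (P 1 j) (P 0 j) x)) (P 0 j))
    (hne : ∃ j, P 0 j ≠ P 1 j)
    (W : Matrix (Fin n) (Fin n) ℝ) (hW : SocialHT.IsErgodicWeight W)
    (π : Fin n → ℝ) (hπ : SocialHT.IsStationary W π) :
    -- both errors of every node, for weights `π⁻¹`, threshold `0` and any tie-breaking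
    (∀ (i : Fin n) (η : ℕ → ℝ), (∀ t, η t ∈ Set.Icc (0 : ℝ) 1) →
      SocialHT.HasExponent
        (fun t => SocialHT.typeI P t (SocialHT.lbrTest W P (fun j => (π j)⁻¹) 0 (η t) i t))
        (SocialHT.chernoffInformation (Measure.pi (P 0)) (Measure.pi (P 1))) ∧
      SocialHT.HasExponent
        (fun t => SocialHT.typeII P t (SocialHT.lbrTest W P (fun j => (π j)⁻¹) 0 (η t) i t))
        (SocialHT.chernoffInformation (Measure.pi (P 0)) (Measure.pi (P 1)))) ∧
    -- Bayes risks: optimal centralised, zero-threshold test, optimal decentralised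
    (∀ ξ : Fin 2 → ℝ, (∀ θ, 0 < ξ θ) → ξ 0 + ξ 1 = 1 →
      SocialHT.HasExponent (SocialHT.centralBayesRisk P ξ)
        (SocialHT.chernoffInformation (Measure.pi (P 0)) (Measure.pi (P 1))) ∧
      ∀ i : Fin n,
        (∀ η : ℕ → ℝ, (∀ t, η t ∈ Set.Icc (0 : ℝ) 1) →
          SocialHT.HasExponent
            (fun t => SocialHT.bayesRisk P ξ t
              (SocialHT.lbrTest W P (fun j => (π j)⁻¹) 0 (η t) i t))
            (SocialHT.chernoffInformation (Measure.pi (P 0)) (Measure.pi (P 1)))) ∧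
        SocialHT.HasExponent (SocialHT.nodeBayesRisk W P (fun j => (π j)⁻¹) ξ i)
          (SocialHT.chernoffInformation (Measure.pi (P 0)) (Measure.pi (P 1))) ∧
        SocialHT.HasExponent (SocialHT.nodeBayesRiskOpt W P ξ i)
          (SocialHT.chernoffInformation (Measure.pi (P 0)) (Measure.pi (P 1)))) := by
  have herr := fun i (η : ℕ → ℝ) (hη : ∀ t, η t ∈ Set.Icc (0 : ℝ) 1) =>
    SocialHT.hasExponent_typeI_typeII hac01 hac10 hmgf hne hW hπ i hη
  refine ⟨herr, fun ξ hξ _ => ?_⟩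
  let m : ℕ → ℝ := fun t => min (ξ 0) (ξ 1) *
    (SocialHT.obsLaw P 0 t).real {x | 0 < SocialHT.weightedLlr P (fun _ _ => 1) t x}
  have hlow : SocialHT.HasExponent m
      (SocialHT.chernoffInformation (Measure.pi (P 0)) (Measure.pi (P 1))) := by
    refine SocialHT.HasExponent.const_mul (lt_min (hξ 0) (hξ 1)) ?_
    refine (SocialHT.hasExponent_of_weightedLlr hac01 hac10 hmgf hne
      (fun _ => tendsto_const_nhds)).1 fun t => ⟨le_rfl, ?_⟩
    exact measureReal_mono fun x hx => le_of_lt (Set.mem_ofPred.1 hx)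
  have hm : ∀ t φ, Measurable φ → (∀ x, φ x ∈ Set.Icc (0 : ℝ) 1) →
      m t ≤ SocialHT.bayesRisk P ξ t φ := fun t φ hφ h01 =>
    SocialHT.min_mul_measureReal_le_bayesRisk hac01 hac10 hmgf hξ hφ h01
  have hrisk := fun i (η : ℕ → ℝ) (hη : ∀ t, η t ∈ Set.Icc (0 : ℝ) 1) =>
    ((herr i η hη).1.const_mul (hξ 0)).add ((herr i η hη).2.const_mul (hξ 1))
  have h0 : (0 : ℝ) ∈ Set.Icc (0 : ℝ) 1 := ⟨le_rfl, zero_le_one⟩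
  have hnode : ∀ r i t, m t ≤ SocialHT.nodeBayesRisk W P r ξ i t := fun r i t =>
    le_csInf ⟨_, 0, 0, h0, rfl⟩ (by
      rintro _ ⟨γ, η, hη, rfl⟩
      exact hm t _ (SocialHT.measurable_lbrTest γ η i t) (SocialHT.lbrTest_mem_Icc hη γ i t))
  have hnode_le : ∀ i t, SocialHT.nodeBayesRisk W P (fun j => (π j)⁻¹) ξ i t ≤
      SocialHT.bayesRisk P ξ t (SocialHT.lbrTest W P (fun j => (π j)⁻¹) 0 0 i t) := fun i t =>
    csInf_le ⟨m t, by
      rintro _ ⟨γ, η, hη, rfl⟩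
      exact hm t _ (SocialHT.measurable_lbrTest γ η i t) (SocialHT.lbrTest_mem_Icc hη γ i t)⟩
      ⟨0, 0, h0, rfl⟩
  refine ⟨?_, fun i => ⟨hrisk i, ?_, ?_⟩⟩
  · -- Any node provides a competitor in the centralised problem.
    obtain ⟨i, -⟩ := hne
    refine hlow.squeeze (hrisk i (fun _ => 0) fun _ => h0) (fun t => ?_) fun t => ?_
    · refine le_csInf ⟨_, fun _ => 0, measurable_const, fun _ => h0, rfl⟩ ?_
      rintro _ ⟨φ, hφ, h01, rfl⟩
      exact hm t φ hφ h01
    · refine csInf_le ⟨m t, ?_⟩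
        ⟨SocialHT.lbrTest W P (fun j => (π j)⁻¹) 0 0 i t, SocialHT.measurable_lbrTest 0 0 i t,
          SocialHT.lbrTest_mem_Icc h0 0 i t, rfl⟩
      rintro _ ⟨φ, hφ, h01, rfl⟩
      exact hm t φ hφ h01
  · exact hlow.squeeze (hrisk i (fun _ => 0) fun _ => h0) (hnode _ i) (hnode_le i)
  · refine hlow.squeeze (hrisk i (fun _ => 0) fun _ => h0) (fun t => ?_) fun t => ?_
    · refine le_csInf ⟨_, fun _ => 1, fun _ => one_pos, rfl⟩ ?_
      rintro _ ⟨r, -, rfl⟩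
      exact hnode r i t
    · refine le_trans (b := SocialHT.nodeBayesRisk W P (fun j => (π j)⁻¹) ξ i t) ?_ (hnode_le i t)
      refine csInf_le ⟨m t, ?_⟩ ⟨fun j => (π j)⁻¹, fun j => inv_pos.2 (hπ.pos hW j), rfl⟩
      rintro _ ⟨r, -, rfl⟩
      exact hnode r i t
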